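/- Let $d\ge1$, $K\ge 1$, $p=d+1$, let $T_1,\dots,T_d>1$ and $T_p=N$ be integers and $\sigma>0$. For $\theta=(\theta_{i,k})_{1\le i\le p,\,1\le k\le K}$ with $\theta_{i,k}\in\mathbb C^{T_i}$, let $y=\sum_{k=1}^{K}\theta_{1,k}\otimes\dots\otimes\theta_{p,k}+w$, where $w$ has i.i.d. circularly symmetric complex Gaussian entries of variance $\sigma^2$, and write $\mathbb E_\theta$ for the expectation when the parameter is $\theta$. Fix a true parameter $x=(x_{i,k})$ with $\|x_{i,k}\|^2=T_i$ for $i\le d$ (the last mode $x_{p,k}=h_k\in\mathbb C^N$ is unconstrained), and let $$\Theta_x=\{\theta:\ \|\theta_{i,k}\|^2=T_i,\ \operatorname{Im}(x_{i,k}^H\theta_{i,k})=0\ \text{ for all } i\le d,\ k\le K\}.$$ Let $\hat z=\hat z(y)$ be an estimator, $\hat z=(\hat z_{i,k})$, that takes its values in $\Theta_x$ almost surely and whose bias is given by real functions $\alpha_{i,k}$ (in particular, possibly, constants in $[0,1]$) through $\mathbb E_\theta[\hat z_{i,k}]=\alpha_{i,k}(\theta)\,\theta_{i,k}$ for all $i\le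 d$, $k\le K$ and all $\theta\in\Theta_x$ near $x$; it is enough that this holds to first order at $x$, that is, $\mathbb E_\theta[\hat z_{i,k}]=\alpha_{i,k}(\theta)\theta_{i,k}+o(\|\theta-x\|)$ as $\theta\to x$ in $\Theta_x$, with equality at $\theta=x$. Write $\alpha_{i,k}=\alpha_{i,k}(x)$ and, when $\alpha_{i,k}\neq0$, $$\xi_{i,k}=\frac{\mathbb E_x\big[\|\hat z_{i,k}-\alpha_{i,k}x_{i,k}\|^2\big]}{T_i\alpha_{i,k}^2}.$$ For $i\le d$ let $s_{-i,k}=\bigotimes_{j\ne i}x_{j,k}$, let $S_{-i}$ be the matrix with columns $s_{-i,1},\dots,s_{-i,K}$, let $\Gamma_i=S_{-i}^HS_{-i}$, let $S_{-i,-k}$ be $S_{-i}$ without its $k$-th column, and let $P^\perp_{S_{-i,-k}}$ be the orthogonal projection onto the orthogonal complement of its column span. Let $1\le i\le d$, assume that $\Gamma_i$ is invertible, and let $\eta_i^->0$ and $\eta_i^+$ be real constants with $$\eta_i^-\operatorname{diag}\big((\Gamma_i^{-1})_{kk}\big)_{k}\ \preceq\ \Gamma_i^{-1}\ \preceq\ \eta_i^+\operatorname{diag}\big((\Gamma_i^{-1})_{kk}\big)_{k},$$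 where $A\preceq B$ means that $B-A$ is positive semidefinite. Then for every $k$ with $\alpha_{i,k}\ne0$, $$\xi_{i,k}\ \ge\ \xi^*_{i,k}:=\frac{\sigma^2(T_i-1)}{T_i\,\|P^\perp_{S_{-i,-k}}s_{-i,k}\|^2}\left(1-\frac{(\eta_i^+)^2-1}{(T_i-1)\,\eta_i^-}\right).$$ -/

import Mathlib

open MeasureTheory ProbabilityTheory Filter Topology Asymptotics
open scoped ComplexOrder NNReal

noncomputable section

/-- The parameters of the rank-`K` tensor model: for every mode `i` and user `k`, a vector
`θ i k ∈ ℂ^{T i}`. There are `p = d + 1` modes; the modes `Fin.castSucc i` with `i : Fin d` carry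
information and the last one is the channel, so `T (Fin.last d)` is the number `N` of antennas. -/
abbrev Params (d K : ℕ) (T : Fin (d + 1) → ℕ) : Type :=
  (i : Fin (d + 1)) → Fin K → EuclideanSpace ℂ (Fin (T i))

/-- The received signal, an element of the tensor product of the spaces `ℂ^{T i}` over all modes,
in coordinates. -/
abbrev Obs {d : ℕ} (T : Fin (d + 1) → ℕ) : Type :=
  ((i : Fin (d + 1)) → Fin (T i)) → ℂ

/-- The noise-free signal `∑ₖ x_{1,k} ⊗ ⋯ ⊗ x_{d,k} ⊗ h_k`. -/
def signal {d K : ℕ} {T : Fin (d + 1) → ℕ} (θ : Params d K T) : Obs T :=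
  fun t => ∑ k, ∏ i, θ i k (t i)

/-- The circularly symmetric complex Gaussian law with `E|w|² = σ²`: independent real and
imaginary parts, each of variance `σ² / 2`. -/
def complexGaussian (σ : ℝ) : Measure ℂ :=
  ((gaussianReal 0 (Real.toNNReal (σ ^ 2 / 2))).prod
    (gaussianReal 0 (Real.toNNReal (σ ^ 2 / 2)))).map Complex.measurableEquivRealProd.symm

/-- The law of `y = signal θ + w`, where `w` has i.i.d. complex Gaussian entries. -/
def obsLaw {d K : ℕ} {T : Fin (d + 1) → ℕ} (σ : ℝ) (θ : Params d K T) : Measure (Obs T) :=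
  (Measure.pi fun _ => complexGaussian σ).map fun w => signal θ + w

/-- The norm and phase constraints on the information-bearing modes, the phase being fixed
relative to the true parameter `x`. -/
def constraintSet {d K : ℕ} {T : Fin (d + 1) → ℕ} (x : Params d K T) : Set (Params d K T) :=
  {θ | ∀ (i : Fin d) (k : Fin K),
    ‖θ i.castSucc k‖ ^ 2 = (T i.castSucc : ℝ) ∧
    (inner ℂ (x i.castSucc k) (θ i.castSucc k)).im = 0}

/-- The bias assumption at the true parameter `x`:
`E_θ[ẑ_{i,k}] = α_{i,k}(θ) θ_{i,k}` for the information-bearing modes, as an identity in the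
parameter `θ` that varies in the constraint set, valid up to first order at `x`.
An estimator for which it holds exactly for all admissible `θ` near `x`, with constant
or varying `α`, is covered. Taking `θ = x` gives `E_x[ẑ_{i,k}] = α_{i,k}(x) x_{i,k}`. -/
def HasScalarBias {d K : ℕ} {T : Fin (d + 1) → ℕ} (σ : ℝ) (x : Params d K T)
    (z : Obs T → Params d K T) (α : Params d K T → Fin d → Fin K → ℝ) : Prop :=
  ∀ (i : Fin d) (k : Fin K),
    (fun θ : Params d K T =>
        (∫ y, z y i.castSucc k ∂(obsLaw σ θ)) - (α θ i k : ℂ) • θ i.castSucc k)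
      =o[𝓝[constraintSet x] x] (fun θ => θ - x)

/-- The normalized variance `ξ_{i,k} = E‖ẑ_{i,k} - a x_{i,k}‖² / (T_i a²)`. -/
def normalizedVariance {d K : ℕ} {T : Fin (d + 1) → ℕ} (σ : ℝ) (x : Params d K T)
    (z : Obs T → Params d K T) (a : ℝ) (i : Fin (d + 1)) (k : Fin K) : ℝ :=
  (∫ y, ‖z y i k - (a : ℂ) • x i k‖ ^ 2 ∂(obsLaw σ x)) / ((T i : ℝ) * a ^ 2)

/-- The partial product `s_{-i,k}`: the tensor product of the `x_{j,k}` over all modes `j ≠ i`. -/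
def partialProduct {d K : ℕ} {T : Fin (d + 1) → ℕ} (x : Params d K T) (i : Fin (d + 1))
    (k : Fin K) : EuclideanSpace ℂ ((j : {j : Fin (d + 1) // j ≠ i}) → Fin (T j)) :=
  WithLp.toLp 2 fun t => ∏ j : {j : Fin (d + 1) // j ≠ i}, x j k (t j)

/-- The matrix `S_{-i}` with columns `s_{-i,k}`. -/
def partialMatrix {d K : ℕ} {T : Fin (d + 1) → ℕ} (x : Params d K T) (i : Fin (d + 1)) :
    Matrix ((j : {j : Fin (d + 1) // j ≠ i}) → Fin (T j)) (Fin K) ℂ :=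
  Matrix.of fun t k => partialProduct x i k t

/-- The Gram matrix `Γ_i = S_{-i}ᴴ S_{-i}`. -/
def gramMatrix {d K : ℕ} {T : Fin (d + 1) → ℕ} (x : Params d K T) (i : Fin (d + 1)) :
    Matrix (Fin K) (Fin K) ℂ :=
  (partialMatrix x i).conjTranspose * partialMatrix x i

/-- The diagonal matrix with the diagonal entries of `Γ_i⁻¹`. -/
def gramInvDiag {d K : ℕ} {T : Fin (d + 1) → ℕ} (x : Params d K T) (i : Fin (d + 1)) :
    Matrix (Fin K) (Fin K) ℂ :=
  Matrix.diagonal fun k => (gramMatrix x i)⁻¹ k k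

/-- The vector `P^⊥_{S_{-i,-k}} s_{-i,k}`: the component of `s_{-i,k}` orthogonal to the other
columns of `S_{-i}`. -/
def residualVec {d K : ℕ} {T : Fin (d + 1) → ℕ} (x : Params d K T) (i : Fin (d + 1)) (k : Fin K) :
    EuclideanSpace ℂ ((j : {j : Fin (d + 1) // j ≠ i}) → Fin (T j)) :=
  (Submodule.span ℂ (partialProduct x i '' {k' | k' ≠ k}))ᗮ.starProjection (partialProduct x i k)

/-- The explicit lower bound `ξ*_{i,k}`. -/
def xiStar {d K : ℕ} {T : Fin (d + 1) → ℕ} (σ : ℝ) (x : Params d K T) (ηm ηp : ℝ)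
    (i : Fin (d + 1)) (k : Fin K) : ℝ :=
  σ ^ 2 * ((T i : ℝ) - 1) / ((T i : ℝ) * ‖residualVec x i k‖ ^ 2) *
    (1 - (ηp ^ 2 - 1) / (((T i : ℝ) - 1) * ηm))

end

/-! The bound is a Cramér–Rao inequality in which only mode `i` varies. Write `G = Γ⁻¹`, let `g l`
be its diagonal entries, and `e l = x l / √T`. Along a curve in the constraint set with velocity
`v`, `v l ⊥ x l`, the Fisher information is `(2/σ²) ∑ Γ l m ⟪v l, v m⟫`. If `u ⊥ x k`, the mean of
`⟪u, ẑ k⟫` has derivative `α ⟪u, v k⟫`: the variation of `α` multiplies `x k`, which `u` does not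
see. The Hammersley–Chapman–Robbins inequality gives this without differentiating under the integral
(`sq_deriv_mean_le`, `sq_bias_mul_re_inner_le`).

The best `v` is the solution of a quadratic problem under the constraints `v l ⊥ e l`. Its
multipliers `c` solve `M c = b`, with `M` the entrywise product of `G` and the Gram matrix of `e`,
and the value is `g k ‖u‖² - b* M⁻¹ b`. The lower bound on `G` passes to `M` as in Schur's product
theorem, hence `b* M⁻¹ b ≤ ηm⁻¹ ∑ ‖b l‖² / g l` (`exists_orthogonal_direction`).

Summing over the projections `u` of a basis onto the complement of `e k` turns `‖u‖²` into `T - 1`.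
The loss is at most `ηm⁻¹ (ηp² - 1) g k`, by `sum_sq_norm_col_div_le` and because the term `l = k`
vanishes. Finally `g k = ‖P^⊥ s k‖⁻²`. -/

/-! ### Likelihood ratios of translated Gaussian laws. -/

/-- The translate of `μ` by `m` has a density with respect to `μ`, of second moment `exp c`. -/
def HasShiftDensity {E : Type*} [Add E] [MeasurableSpace E] (μ : Measure E) (m : E) (c : ℝ) :
    Prop :=
  ∃ L : E → ENNReal, Measurable L ∧ μ.map (fun w => m + w) = μ.withDensity L ∧
    ∫⁻ w, L w ^ 2 ∂μ = ENNReal.ofReal (Real.exp c)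

theorem hasShiftDensity_gaussianReal (m : ℝ) {v : ℝ≥0} (hv : v ≠ 0) :
    HasShiftDensity (gaussianReal 0 v) m (m ^ 2 / v) := by
  have hv' : (0 : ℝ) < v := by positivity
  refine ⟨fun w => ENNReal.ofReal (Real.exp ((m / v) * w - m ^ 2 / (2 * v))), by fun_prop, ?_, ?_⟩
  · rw [gaussianReal_map_const_add, gaussianReal_of_var_ne_zero _ hv,
      gaussianReal_of_var_ne_zero _ hv, ← withDensity_mul _ (measurable_gaussianPDF _ _)
        (by fun_prop)]
    congr 1
    ext w
    simp only [Pi.mul_apply, gaussianPDF]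
    rw [← ENNReal.ofReal_mul (gaussianPDFReal_nonneg _ _ _)]
    congr 1
    simp only [gaussianPDFReal]
    rw [mul_assoc _ (Real.exp _), ← Real.exp_add]
    congr 2
    field_simp
    ring
  -- The square of the density is a constant times `exp ((2m/v) w)`, so its integral is the Gaussian
  -- moment generating function at `2m/v`.
  · have h1 : ∀ w : ℝ, ENNReal.ofReal (Real.exp ((m / v) * w - m ^ 2 / (2 * v))) ^ 2 =
        ENNReal.ofReal (Real.exp (-(m ^ 2 / v)) * Real.exp ((2 * m / v) * w)) := by
      intro w
      rw [← ENNReal.ofReal_pow (Real.exp_pos _).le, ← Real.exp_nat_mul, ← Real.exp_add]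
      congr 2
      field_simp
      push_cast
      ring
    simp_rw [h1]
    rw [← ofReal_integral_eq_lintegral_ofReal]
    · rw [integral_const_mul]
      have := congrFun (mgf_id_gaussianReal (μ := 0) (v := v)) (2 * m / v)
      simp only [mgf, id] at this
      rw [this, ← Real.exp_add]
      congr 2
      field_simp
      ring
    · exact (integrable_exp_mul_gaussianReal _).const_mul _
    · exact ae_of_all _ fun w => by positivity

theorem HasShiftDensity.prod {E F : Type*} [AddGroup E] [AddGroup F] [MeasurableSpace E]
    [MeasurableSpace F] [MeasurableAdd E] [MeasurableAdd F] {μ : Measure E} {ν : Measure F}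
    [IsProbabilityMeasure μ] [IsProbabilityMeasure ν]
    {m : E} {n : F} {a b : ℝ} (hμ : HasShiftDensity μ m a) (hν : HasShiftDensity ν n b) :
    HasShiftDensity (μ.prod ν) (m, n) (a + b) := by
  obtain ⟨L, hL, hLd, hL2⟩ := hμ
  obtain ⟨M, hM, hMd, hM2⟩ := hν
  refine ⟨fun z => L z.1 * M z.2, by fun_prop, ?_, ?_⟩
  · rw [← prod_withDensity hL hM, ← hLd, ← hMd,
      Measure.map_prod_map _ _ (measurable_const_add m) (measurable_const_add n)]
    rfl
  · simp_rw [mul_pow]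
    rw [lintegral_prod_mul (f := fun x => L x ^ 2) (g := fun x => M x ^ 2) (by fun_prop)
      (by fun_prop), hL2, hM2,
      ← ENNReal.ofReal_mul (Real.exp_pos _).le, Real.exp_add]

theorem HasShiftDensity.map {E F : Type*} [Add E] [Add F] [MeasurableSpace E]
    [MeasurableSpace F] [MeasurableAdd E] [MeasurableAdd F] {μ : Measure E}
    {m : E} {n : F} {a : ℝ} (hμ : HasShiftDensity μ m a) (e : E ≃ᵐ F)
    (he : ∀ w, e (m + w) = n + e w) : HasShiftDensity (μ.map e) n a := by
  obtain ⟨L, hL, hLd, hL2⟩ := hμ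
  refine ⟨fun z => L (e.symm z), by fun_prop, ?_, ?_⟩
  · rw [Measure.map_map (measurable_const_add n) e.measurable]
    have : (fun w => n + w) ∘ e = e ∘ (fun w => m + w) := by
      ext w; simp [he]
    rw [this, ← Measure.map_map e.measurable (measurable_const_add m), hLd]
    ext s hs
    rw [Measure.map_apply e.measurable hs, withDensity_apply _ (e.measurable hs),
      withDensity_apply _ hs, setLIntegral_map hs (by fun_prop) e.measurable]
    simp
  · rw [lintegral_map (by fun_prop) e.measurable]
    simpa using hL2

theorem lintegral_pi_prod {ι : Type*} [Fintype ι] {E : Type*} [MeasurableSpace E]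
    (μ : ι → Measure E) [∀ i, IsProbabilityMeasure (μ i)] (f : ι → E → ENNReal)
    (hf : ∀ i, Measurable (f i)) :
    ∫⁻ w, ∏ i, f i (w i) ∂(Measure.pi μ) = ∏ i, ∫⁻ x, f i x ∂(μ i) := by
  have h := lintegral_prod_eq_prod_lintegral_of_indepFun Finset.univ
    (fun i (w : ι → E) => f i (w i)) (iIndepFun_pi (μ := μ) (fun i => (hf i).aemeasurable))
    (fun i => by fun_prop)
  rw [h]
  refine Finset.prod_congr rfl fun i _ => ?_
  rw [← (measurePreserving_eval μ i).lintegral_comp (hf i)]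

theorem HasShiftDensity.pi {ι : Type*} [Fintype ι] {E : Type*} [MeasurableSpace E]
    [AddGroup E] [MeasurableAdd E] {μ : ι → Measure E} [∀ i, IsProbabilityMeasure (μ i)]
    {m : ι → E} {a : ι → ℝ} (h : ∀ i, HasShiftDensity (μ i) (m i) (a i)) :
    HasShiftDensity (Measure.pi μ) m (∑ i, a i) := by
  choose L hL hLd hL2 using h
  have hprob : ∀ i, IsProbabilityMeasure ((μ i).map (fun w => m i + w)) := fun i =>
    Measure.isProbabilityMeasure_map (measurable_const_add _).aemeasurable
  refine ⟨fun w => ∏ i, L i (w i), by fun_prop, ?_, ?_⟩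
  · have h1 : (Measure.pi μ).map (fun w => m + w) =
        Measure.pi fun i => (μ i).map (fun w => m i + w) := by
      rw [← Measure.pi_map_pi (fun i => (measurable_const_add (m i)).aemeasurable)]
      rfl
    rw [h1]
    refine Measure.pi_eq fun s hs => ?_
    rw [withDensity_apply _ (MeasurableSet.univ_pi hs),
      ← lintegral_indicator (MeasurableSet.univ_pi hs)]
    have h2 : ((Set.univ.pi s).indicator fun w : ι → E => ∏ i, L i (w i)) =
        fun w => ∏ i, (s i).indicator (L i) (w i) := by
      ext w
      by_cases hw : w ∈ Set.univ.pi s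
      · rw [Set.indicator_of_mem hw]
        refine Finset.prod_congr rfl fun i _ => ?_
        rw [Set.indicator_of_mem (hw i trivial)]
      · rw [Set.indicator_of_notMem hw]
        simp only [Set.mem_pi, Set.mem_univ, true_imp_iff, not_forall] at hw
        obtain ⟨i, hi⟩ := hw
        exact (Finset.prod_eq_zero (Finset.mem_univ i) (Set.indicator_of_notMem hi _)).symm
    rw [h2, lintegral_pi_prod μ _ fun i => (hL i).indicator (hs i)]
    refine Finset.prod_congr rfl fun i _ => ?_
    rw [hLd, withDensity_apply _ (hs i), lintegral_indicator (hs i)]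
  · simp_rw [← Finset.prod_pow]
    rw [lintegral_pi_prod μ (fun i x => L i x ^ 2) fun i => by fun_prop]
    simp_rw [hL2]
    rw [← ENNReal.ofReal_prod_of_nonneg (fun i _ => (Real.exp_pos _).le), Real.exp_sum]

instance isProbabilityMeasure_complexGaussian (σ : ℝ) :
    IsProbabilityMeasure (complexGaussian σ) :=
  Measure.isProbabilityMeasure_map Complex.measurableEquivRealProd.symm.measurable.aemeasurable

/-- The factor 2 arises because each real coordinate has variance `σ²/2`. -/
theorem hasShiftDensity_complexGaussian {σ : ℝ} (hσ : 0 < σ) (m : ℂ) :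
    HasShiftDensity (complexGaussian σ) m (2 * ‖m‖ ^ 2 / σ ^ 2) := by
  have hv : Real.toNNReal (σ ^ 2 / 2) ≠ 0 := by
    rw [Ne, Real.toNNReal_eq_zero, not_le]; positivity
  have h := ((hasShiftDensity_gaussianReal m.re hv).prod
    (hasShiftDensity_gaussianReal m.im hv)).map (n := m) Complex.measurableEquivRealProd.symm
    (fun w => Complex.ext rfl rfl)
  convert h using 1
  · rfl
  rw [Real.coe_toNNReal _ (by positivity), ← Complex.normSq_eq_norm_sq, Complex.normSq_apply]
  field_simp

instance isProbabilityMeasure_obsLaw {d K : ℕ} {T : Fin (d + 1) → ℕ} (σ : ℝ)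
    (θ : Params d K T) : IsProbabilityMeasure (obsLaw σ θ) :=
  Measure.isProbabilityMeasure_map (measurable_const_add _).aemeasurable

theorem exists_density_obsLaw {d K : ℕ} {T : Fin (d + 1) → ℕ} {σ : ℝ} (hσ : 0 < σ)
    (x θ : Params d K T) :
    ∃ L : Obs T → ENNReal, Measurable L ∧ obsLaw σ θ = (obsLaw σ x).withDensity L ∧
      ∫⁻ y, L y ^ 2 ∂(obsLaw σ x) = ENNReal.ofReal
        (Real.exp (2 * (∑ τ, ‖signal θ τ - signal x τ‖ ^ 2) / σ ^ 2)) := by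
  have h := HasShiftDensity.pi (μ := fun _ : (i : Fin (d + 1)) → Fin (T i) => complexGaussian σ)
    fun τ => hasShiftDensity_complexGaussian hσ (signal θ τ - signal x τ)
  obtain ⟨L, hL, hLd, hL2⟩ := h.map (n := fun τ => signal θ τ - signal x τ)
    (MeasurableEquiv.addLeft (signal x)) (fun w => by
      ext τ; simp only [MeasurableEquiv.coe_addLeft, Pi.add_apply]; ring)
  refine ⟨L, hL, ?_, ?_⟩
  · have : obsLaw σ x = (Measure.pi fun _ => complexGaussian σ).map
      (MeasurableEquiv.addLeft (signal x)) := rfl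
    rw [this, ← hLd, obsLaw, Measure.map_map (measurable_const_add _)
      (MeasurableEquiv.measurable _)]
    congr 1
    ext w τ
    simp only [Function.comp, MeasurableEquiv.coe_addLeft, Pi.add_apply]; ring
  · rw [Finset.mul_sum, Finset.sum_div]
    exact hL2

/-! ### The information inequality for a finite shift. -/

/-- The Hammersley–Chapman–Robbins inequality: the mean of `g` changes, between the laws `P` and
`L P`, by at most the standard deviation of `g` times that of `L`. -/
theorem sq_integral_withDensity_sub_le {E : Type*} [MeasurableSpace E] {P : Measure E}
    [IsProbabilityMeasure P] {L : E → ENNReal} (hL : Measurable L)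
    [IsProbabilityMeasure (P.withDensity L)] {C : ℝ} (hC0 : 0 ≤ C)
    (hC : ∫⁻ w, L w ^ 2 ∂P = ENNReal.ofReal C)
    {g : E → ℝ} (hg : Measurable g) {B : ℝ} (hB : ∀ᵐ w ∂P, |g w| ≤ B) :
    (∫ w, g w ∂(P.withDensity L) - ∫ w, g w ∂P) ^ 2 ≤ (∫ w, g w ^ 2 ∂P) * (C - 1) := by
  have hfin : ∀ᵐ w ∂P, L w < ⊤ := by
    have := ae_lt_top (hL.pow_const 2) (by rw [hC]; exact ENNReal.ofReal_ne_top)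
    filter_upwards [this] with w hw
    simpa using hw
  set l : E → ℝ := fun w => (L w).toReal with hl
  have hlm : Measurable l := hL.ennreal_toReal
  have hgm : MemLp g 2 P := MemLp.of_bound hg.aestronglyMeasurable B (by simpa using hB)
  have hlint : ∫⁻ w, ENNReal.ofReal (l w ^ 2) ∂P = ENNReal.ofReal C := by
    rw [← hC]
    refine lintegral_congr_ae ?_
    filter_upwards [hfin] with w hw
    rw [ENNReal.ofReal_pow ENNReal.toReal_nonneg, ENNReal.ofReal_toReal hw.ne]
  have hlsq : Integrable (fun w => l w ^ 2) P := by
    refine ⟨(hlm.pow_const 2).aestronglyMeasurable, ?_⟩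
    rw [hasFiniteIntegral_iff_ofReal (ae_of_all _ fun w => sq_nonneg _), hlint]
    exact ENNReal.ofReal_lt_top
  have hlL2 : MemLp l 2 P := (memLp_two_iff_integrable_sq hlm.aestronglyMeasurable).2 hlsq
  have hl2 : ∫ w, l w ^ 2 ∂P = C := by
    rw [integral_eq_lintegral_of_nonneg_ae (ae_of_all _ fun w => sq_nonneg _)
      (hlm.pow_const 2).aestronglyMeasurable, hlint, ENNReal.toReal_ofReal hC0]
  have hli : Integrable l P := hlL2.integrable (by norm_num)
  have hl1 : ∫ w, l w ∂P = 1 := by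
    rw [integral_toReal hL.aemeasurable hfin, ← setLIntegral_univ, ← withDensity_apply _ .univ]
    simp
  have hgi : Integrable g P := hgm.integrable (by norm_num)
  have hgl : Integrable (fun w => g w * l w) P := hgm.integrable_mul hlL2
  have hg2 : Integrable (fun w => g w ^ 2) P := hgm.integrable_sq
  have hd : ∫ w, g w ∂(P.withDensity L) = ∫ w, g w * l w ∂P := by
    rw [integral_withDensity_eq_integral_toReal_smul hL hfin]
    exact integral_congr_ae (ae_of_all _ fun w => by simp [hl, mul_comm])
  rw [hd]
  set D := ∫ w, g w * l w ∂P - ∫ w, g w ∂P with hD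
  -- This quadratic in `c` is `∫ (g - c (l - 1))²`; its discriminant gives the claim. The second
  -- moment of `g` need not be centred: in the application `g` has mean zero where it matters.
  have key : ∀ c : ℝ, 0 ≤ (C - 1) * (c * c) + (-2 * D) * c + ∫ w, g w ^ 2 ∂P := by
    intro c
    have h0 : 0 ≤ ∫ w, (g w - c * (l w - 1)) ^ 2 ∂P := integral_nonneg fun w => sq_nonneg _
    have h1 : ∀ w, (g w - c * (l w - 1)) ^ 2 =
        g w ^ 2 + (-2 * c) * (g w * l w) + (2 * c) * g w + c ^ 2 * l w ^ 2
          + (-2 * c ^ 2) * l w + c ^ 2 := fun w => by ring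
    simp_rw [h1] at h0
    rw [integral_add (by fun_prop) (by fun_prop), integral_add (by fun_prop) (by fun_prop),
      integral_add (by fun_prop) (by fun_prop), integral_add (by fun_prop) (by fun_prop),
      integral_add (by fun_prop) (by fun_prop)] at h0
    simp only [integral_const_mul, hl1, hl2, integral_const, probReal_univ, smul_eq_mul] at h0
    rw [hD]
    linarith
  have := discrim_le_zero key
  unfold discrim at this
  linarith

/-! ### The optimal direction under the orthogonality constraints. -/

section Gram

variable {ι n : Type*} [Fintype ι] [Fintype n]

/-- The form of the entrywise product at `c` is the sum over coordinates `j` of the form of `G` at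
`(c l * e l j)`; since `e l` is a unit vector, the lower bounds add up to the one for `c`. -/
theorem le_re_form_hadamard_gram {G : Matrix ι ι ℂ} {g : ι → ℝ} {η : ℝ}
    (hlow : ∀ c : ι → ℂ, η * ∑ l, g l * ‖c l‖ ^ 2 ≤ (star c ⬝ᵥ G.mulVec c).re)
    {e : ι → EuclideanSpace ℂ n} (he : ∀ l, ‖e l‖ = 1) (c : ι → ℂ) :
    η * ∑ l, g l * ‖c l‖ ^ 2 ≤
      (star c ⬝ᵥ (Matrix.of fun l m => G l m * inner ℂ (e l) (e m)).mulVec c).re := by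
  have h1 : star c ⬝ᵥ (Matrix.of fun l m => G l m * inner ℂ (e l) (e m)).mulVec c =
      ∑ j, star (fun l => c l * e l j) ⬝ᵥ G.mulVec (fun l => c l * e l j) := by
    simp only [dotProduct, Matrix.mulVec, Matrix.of_apply, PiLp.inner_apply, RCLike.inner_apply,
      Finset.mul_sum, Finset.sum_mul, Pi.star_apply, star_mul', RCLike.star_def]
    conv_rhs => rw [Finset.sum_comm]
    refine Finset.sum_congr rfl fun l _ => ?_
    conv_rhs => rw [Finset.sum_comm]
    refine Finset.sum_congr rfl fun m _ => Finset.sum_congr rfl fun j _ => ?_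
    ring
  rw [h1, Complex.re_sum]
  have h2 : η * ∑ l, g l * ‖c l‖ ^ 2 = ∑ j, η * ∑ l, g l * ‖c l * e l j‖ ^ 2 := by
    rw [← Finset.mul_sum, Finset.sum_comm]
    congr 1
    refine Finset.sum_congr rfl fun l _ => ?_
    have := EuclideanSpace.norm_sq_eq (e l)
    rw [he l, one_pow] at this
    simp_rw [norm_mul, mul_pow]
    rw [← Finset.mul_sum, ← Finset.mul_sum, ← this, mul_one]
  rw [h2]
  exact Finset.sum_le_sum fun j _ => hlow _

variable [DecidableEq ι]

/-- A direction `v` with `v l ⊥ e l` at which the Cramér–Rao functional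
`2 Re ⟪u, v k⟫ - ‖∑ v l ⊗ s l‖²` is at least the stated bound. -/
theorem exists_orthogonal_direction {G Γ : Matrix ι ι ℂ} (hΓG : Γ * G = 1) (hG : G.IsHermitian)
    {g : ι → ℝ} (hg : ∀ l, 0 < g l) (hgG : ∀ l, G l l = g l) {η : ℝ} (hη : 0 < η)
    (hlow : ∀ c : ι → ℂ, η * ∑ l, g l * ‖c l‖ ^ 2 ≤ (star c ⬝ᵥ G.mulVec c).re)
    {e : ι → EuclideanSpace ℂ n} (he : ∀ l, ‖e l‖ = 1) (k : ι) (u : EuclideanSpace ℂ n) :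
    ∃ v : ι → EuclideanSpace ℂ n, (∀ l, inner ℂ (e l) (v l) = 0) ∧
      ∑ l, ∑ m, Γ l m * inner ℂ (v l) (v m) = inner ℂ (v k) u ∧
      g k * ‖u‖ ^ 2 - η⁻¹ * ∑ l, ‖G l k‖ ^ 2 * ‖inner ℂ (e l) u‖ ^ 2 / g l ≤
        (inner ℂ u (v k)).re := by
  set M : Matrix ι ι ℂ := Matrix.of fun l m => G l m * inner ℂ (e l) (e m) with hM
  have hMlow := le_re_form_hadamard_gram hlow he
  have hinj : Function.Injective M.mulVec := by
    refine (injective_iff_map_eq_zero M.mulVecLin).2 fun c hc => ?_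
    have h := hMlow c
    have hc' : M.mulVec c = 0 := hc
    rw [← hM, hc', dotProduct_zero, Complex.zero_re] at h
    have h0 : ∑ l, g l * ‖c l‖ ^ 2 ≤ 0 := by
      by_contra hcon
      exact absurd h (not_le.2 (mul_pos hη (not_le.1 hcon)))
    have h1 := (Finset.sum_eq_zero_iff_of_nonneg (s := Finset.univ)
      (f := fun l => g l * ‖c l‖ ^ 2) (fun l _ => by have := hg l; positivity)).1
      (le_antisymm h0 (Finset.sum_nonneg fun l _ => by have := hg l; positivity))
    ext l
    have := h1 l (Finset.mem_univ l)
    simpa [(hg l).ne'] using this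
  have hsurj : Function.Surjective M.mulVec :=
    LinearMap.injective_iff_surjective (f := M.mulVecLin).1 hinj
  -- The equation `M c = b` is exactly the constraint `v l ⊥ e l` for the `v` below, which is the
  -- unconstrained optimum `G l k • u` corrected by multipliers.
  set b : ι → ℂ := fun l => G l k * inner ℂ (e l) u with hb
  obtain ⟨c, hc⟩ := hsurj b
  set v : ι → EuclideanSpace ℂ n := fun l => G l k • u - ∑ m, (G l m * c m) • e m with hv
  have horth : ∀ l, inner ℂ (e l) (v l) = 0 := by
    intro l
    have h := congrFun hc l
    simp only [hM, hb, Matrix.mulVec, dotProduct, Matrix.of_apply] at h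
    simp only [hv, inner_sub_right, inner_smul_right, inner_sum]
    rw [← h, sub_eq_zero]
    exact Finset.sum_congr rfl fun m _ => by ring
  -- Stationarity: `Γ v` is `u` in slot `k`, up to multiples of `e l`. Paired with `v l ⊥ e l`,
  -- these multiples drop out of the form.
  have hsum : ∀ l, ∑ m, Γ l m • v m = (if l = k then u else 0) - c l • e l := by
    intro l
    have hone : ∀ m, ∑ j, Γ l j * G j m = if l = m then 1 else 0 := fun m => by
      have := congrFun (congrFun hΓG l) m
      rwa [Matrix.mul_apply, Matrix.one_apply] at this
    simp only [hv, smul_sub, Finset.smul_sum, smul_smul, Finset.sum_sub_distrib]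
    rw [← Finset.sum_smul, hone, Finset.sum_comm]
    simp_rw [← mul_assoc, ← Finset.sum_smul, ← Finset.sum_mul, hone]
    simp
  have hform : ∑ l, ∑ m, Γ l m * inner ℂ (v l) (v m) = inner ℂ (v k) u := by
    have : ∀ l, ∑ m, Γ l m * inner ℂ (v l) (v m) = if l = k then inner ℂ (v l) u else 0 := by
      intro l
      have h2 : inner ℂ (v l) (e l) = 0 := inner_eq_zero_symm.1 (horth l)
      simp_rw [← inner_smul_right]
      rw [← inner_sum, hsum, inner_sub_right, inner_smul_right, h2]
      split_ifs <;> simp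
    simp_rw [this]
    simp
  refine ⟨v, horth, hform, ?_⟩
  have hbc : (star c ⬝ᵥ b).re = (∑ m, star (b m) * c m).re := by
    rw [← Complex.conj_re, dotProduct, map_sum]
    simp [mul_comm]
  have hval : (inner ℂ u (v k)).re = g k * ‖u‖ ^ 2 - (∑ m, star (b m) * c m).re := by
    simp only [hv, inner_sub_right, inner_smul_right, inner_sum, Complex.sub_re]
    congr 1
    · rw [hgG, inner_self_eq_norm_sq_to_K]
      simp [pow_two]
    · congr 1
      refine Finset.sum_congr rfl fun m _ => ?_
      have h1 : star (G m k) = G k m := hG.apply k m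
      simp only [hb, star_mul', h1, RCLike.star_def, inner_conj_symm]
      ring
  have hcb := hMlow c
  rw [← hM, hc, hbc] at hcb
  -- Since `b = M c`, the last term is at most `Re (b* c)` by `hcb`; absorbing it on the left leaves
  -- `Re (b* c) ≤ η⁻¹ ∑ ‖b l‖² / g l`.
  have hyoung : (∑ m, star (b m) * c m).re * 2 ≤
      η⁻¹ * (∑ l, ‖b l‖ ^ 2 / g l) + η * ∑ l, g l * ‖c l‖ ^ 2 := by
    rw [Complex.re_sum, Finset.sum_mul, Finset.mul_sum, Finset.mul_sum, ← Finset.sum_add_distrib]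
    refine Finset.sum_le_sum fun l _ => ?_
    have h1 : (star (b l) * c l).re ≤ ‖b l‖ * ‖c l‖ := by
      refine (Complex.re_le_norm _).trans ?_
      rw [norm_mul, norm_star]
    have h2 : η⁻¹ * (‖b l‖ ^ 2 / g l) + η * (g l * ‖c l‖ ^ 2) - 2 * (‖b l‖ * ‖c l‖) =
        η⁻¹ / g l * (‖b l‖ - η * g l * ‖c l‖) ^ 2 := by
      have := (hg l).ne'
      field_simp
      ring
    have h3 : 0 ≤ η⁻¹ / g l * (‖b l‖ - η * g l * ‖c l‖) ^ 2 := by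
      have := hg l
      positivity
    linarith
  have hb2 : ∑ l, ‖G l k‖ ^ 2 * ‖inner ℂ (e l) u‖ ^ 2 / g l = ∑ l, ‖b l‖ ^ 2 / g l := by
    simp [hb, mul_pow]
  rw [hval, hb2]
  linarith

/-- With `a l = G l k / g l` and `r = S / g k`, positivity at `a - r e_k` gives `S r ≤ a* G a`,
while the upper bound gives `a* G a ≤ ηp S`. Thus `r ≤ ηp`; as `1 ≤ r`, this is stronger than `r ≤
ηp²`. -/
theorem sum_sq_norm_col_div_le {G : Matrix ι ι ℂ} (hG : G.IsHermitian)
    {g : ι → ℝ} (hg : ∀ l, 0 < g l) (hgG : ∀ l, G l l = g l) {ηm ηp : ℝ} (hη : 0 < ηm)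
    (hlow : ∀ c : ι → ℂ, ηm * ∑ l, g l * ‖c l‖ ^ 2 ≤ (star c ⬝ᵥ G.mulVec c).re)
    (hupp : ∀ c : ι → ℂ, (star c ⬝ᵥ G.mulVec c).re ≤ ηp * ∑ l, g l * ‖c l‖ ^ 2) (k : ι) :
    ∑ l, ‖G l k‖ ^ 2 / g l ≤ ηp ^ 2 * g k := by
  set S := ∑ l, ‖G l k‖ ^ 2 / g l with hS
  have hS1 : g k ≤ S := by
    have h := Finset.single_le_sum (f := fun l => ‖G l k‖ ^ 2 / g l)
      (fun l _ => by have := hg l; positivity) (Finset.mem_univ k)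
    have h' : ‖G k k‖ ^ 2 / g k = g k := by
      have := (hg k).ne'
      rw [hgG, Complex.norm_real, Real.norm_eq_abs, sq_abs]
      field_simp
    linarith
  have hpos := hg k
  set a : ι → ℂ := fun l => G l k / g l with ha
  set r : ℝ := S / g k with hr
  -- The form of `G` is nonnegative at `a - r e_k`.
  have h0 : 0 ≤ (star (a - Pi.single k (r : ℂ)) ⬝ᵥ G.mulVec (a - Pi.single k (r : ℂ))).re :=
    le_trans (mul_nonneg hη.le (Finset.sum_nonneg fun l _ => by have := hg l; positivity)) (hlow _)
  have hGa : star a ⬝ᵥ G.mulVec (Pi.single k (r : ℂ)) = ((S * r : ℝ) : ℂ) := by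
    simp only [dotProduct, Matrix.mulVec_single, Pi.smul_apply,
      Matrix.col_apply, op_smul_eq_smul, smul_eq_mul, ha, Pi.star_apply, star_div₀, RCLike.star_def,
      Complex.conj_ofReal]
    push_cast
    rw [hS, Complex.ofReal_sum, Finset.sum_mul]
    refine Finset.sum_congr rfl fun l _ => ?_
    push_cast
    rw [← Complex.conj_mul']
    ring
  have hGa' : star (Pi.single k (r : ℂ)) ⬝ᵥ G.mulVec a = ((S * r : ℝ) : ℂ) := by
    have : star (star a ⬝ᵥ G.mulVec (Pi.single k (r : ℂ))) =
        star (Pi.single k (r : ℂ)) ⬝ᵥ G.mulVec a := by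
      rw [← Matrix.star_dotProduct, Matrix.star_mulVec, hG.eq, ← Matrix.dotProduct_mulVec]
    rw [← this, hGa]
    simp
  have hkk : star (Pi.single k (r : ℂ)) ⬝ᵥ G.mulVec (Pi.single k (r : ℂ)) =
      ((r * g k * r : ℝ) : ℂ) := by
    have : (star (Pi.single k (r : ℂ)) : ι → ℂ) = Pi.single k (r : ℂ) := by
      rw [← Pi.single_star]; simp
    rw [this, single_dotProduct]
    simp [Matrix.mulVec_single, hgG]
    ring
  rw [star_sub, sub_dotProduct, Matrix.mulVec_sub, dotProduct_sub, dotProduct_sub, hGa, hGa', hkk,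
    Complex.sub_re, Complex.sub_re, Complex.sub_re, Complex.ofReal_re, Complex.ofReal_re] at h0
  have ha2 := hupp a
  have haS : ∑ l, g l * ‖a l‖ ^ 2 = S := by
    rw [hS]
    refine Finset.sum_congr rfl fun l _ => ?_
    have := (hg l).ne'
    simp only [ha, norm_div, Complex.norm_real, Real.norm_eq_abs, div_pow, sq_abs]
    field_simp
  rw [haS] at ha2
  have hr' : r * g k = S := by rw [hr]; field_simp
  have hSle : S * r ≤ ηp * S := by
    rw [hr'] at h0; linarith
  have hSpos : 0 < S := hpos.trans_le hS1
  have hrle : r ≤ ηp := le_of_mul_le_mul_left (by linarith) hSpos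
  have hr1 : 1 ≤ r := by rw [hr, le_div_iff₀ hpos]; linarith
  have : r ≤ ηp ^ 2 := by nlinarith
  rw [← hr']
  exact mul_le_mul_of_nonneg_right this hpos.le

end Gram

/-! ### Projection onto the complement of a unit vector. -/

section Rejection

variable {n : Type*} [Fintype n]

/-- The component of `u` orthogonal to a unit vector `e`. -/
noncomputable def reject (e u : EuclideanSpace ℂ n) : EuclideanSpace ℂ n := u - (inner ℂ e u : ℂ) • e

theorem inner_reject {e : EuclideanSpace ℂ n} (he : ‖e‖ = 1) (u : EuclideanSpace ℂ n) :
    inner ℂ e (reject e u) = 0 := by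
  simp [reject, inner_self_eq_norm_sq_to_K, he]

theorem inner_reject_left (e u w : EuclideanSpace ℂ n) :
    inner ℂ (reject e u) w = inner ℂ u (reject e w) := by
  simp only [reject, inner_sub_right, inner_smul_right, inner_sub_left, inner_smul_left,
    inner_conj_symm]
  ring

theorem reject_self {e : EuclideanSpace ℂ n} (he : ‖e‖ = 1) : reject e e = 0 := by
  simp [reject, inner_self_eq_norm_sq_to_K, he]

theorem norm_sq_reject {e : EuclideanSpace ℂ n} (he : ‖e‖ = 1) (u : EuclideanSpace ℂ n) :
    ‖reject e u‖ ^ 2 = ‖u‖ ^ 2 - ‖inner ℂ e u‖ ^ 2 := by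
  have h : u = reject e u + (inner ℂ e u : ℂ) • e := by simp [reject]
  have h2 := norm_add_sq (𝕜 := ℂ) (reject e u) ((inner ℂ e u : ℂ) • e)
  rw [← h, inner_smul_right, inner_eq_zero_symm.1 (inner_reject he u), norm_smul, he] at h2
  simp at h2
  linarith

theorem norm_reject_le {e : EuclideanSpace ℂ n} (he : ‖e‖ = 1) (u : EuclideanSpace ℂ n) :
    ‖reject e u‖ ^ 2 ≤ ‖u‖ ^ 2 := by
  rw [norm_sq_reject he]
  linarith [sq_nonneg ‖inner ℂ e u‖]

theorem reject_sub_smul {e : EuclideanSpace ℂ n} (he : ‖e‖ = 1) (u : EuclideanSpace ℂ n) (a : ℂ) :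
    reject e (u - a • e) = reject e u := by
  simp only [reject, inner_sub_right, inner_smul_right, inner_self_eq_norm_sq_to_K, he]
  simp only [Complex.coe_algebraMap, Complex.ofReal_one, one_pow, mul_one, sub_smul]
  abel

/-- The projection is self-adjoint, so this is Parseval for `reject e w`: projected basis vectors
serve in place of an orthonormal basis of the complement of `e`. -/
theorem sum_norm_sq_inner_reject (b : OrthonormalBasis n ℂ (EuclideanSpace ℂ n))
    (e w : EuclideanSpace ℂ n) :
    ∑ j, ‖inner ℂ (reject e (b j)) w‖ ^ 2 = ‖reject e w‖ ^ 2 := by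
  simp_rw [inner_reject_left]
  exact b.sum_sq_norm_inner_right _

theorem sum_norm_sq_reject (b : OrthonormalBasis n ℂ (EuclideanSpace ℂ n))
    {e : EuclideanSpace ℂ n} (he : ‖e‖ = 1) :
    ∑ j, ‖reject e (b j)‖ ^ 2 = Fintype.card n - 1 := by
  simp_rw [norm_sq_reject he]
  rw [Finset.sum_sub_distrib]
  have := b.sum_sq_norm_inner_left e
  rw [this, he]
  simp

theorem le_sum_reject_bound {ι : Type*} [Fintype ι] [DecidableEq ι]
    (b : OrthonormalBasis n ℂ (EuclideanSpace ℂ n)) {G : Matrix ι ι ℂ} {g : ι → ℝ}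
    (hg : ∀ l, 0 < g l) (hgG : ∀ l, G l l = g l) {η B : ℝ} (hη : 0 < η) {k : ι}
    (hB : ∑ l, ‖G l k‖ ^ 2 / g l ≤ B * g k)
    {e : ι → EuclideanSpace ℂ n} (he : ∀ l, ‖e l‖ = 1) :
    g k * ((Fintype.card n - 1) - (B - 1) / η) ≤ ∑ j, (g k * ‖reject (e k) (b j)‖ ^ 2 -
      η⁻¹ * ∑ l, ‖G l k‖ ^ 2 * ‖inner ℂ (e l) (reject (e k) (b j))‖ ^ 2 / g l) := by
  rw [Finset.sum_sub_distrib, ← Finset.mul_sum, ← Finset.mul_sum, sum_norm_sq_reject b (he k),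
    Finset.sum_comm]
  have h1 : ∀ l, ∑ j, ‖G l k‖ ^ 2 * ‖inner ℂ (e l) (reject (e k) (b j))‖ ^ 2 / g l ≤
      ‖G l k‖ ^ 2 / g l - if l = k then g k else 0 := by
    intro l
    have h2 : ∑ j, ‖G l k‖ ^ 2 * ‖inner ℂ (e l) (reject (e k) (b j))‖ ^ 2 / g l =
        ‖G l k‖ ^ 2 / g l * ‖reject (e k) (e l)‖ ^ 2 := by
      rw [← sum_norm_sq_inner_reject b, Finset.mul_sum]
      refine Finset.sum_congr rfl fun j _ => ?_
      rw [norm_inner_symm]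
      ring
    -- For `l = k` the rejection of `e k` along itself is zero, which saves the term `‖G k k‖² / g k
    -- = g k` and turns `B` into `B - 1`.
    rw [h2]
    have hgl := hg l
    split_ifs with hlk
    · subst hlk
      rw [reject_self (he l), hgG, Complex.norm_real, Real.norm_eq_abs, sq_abs]
      simp only [norm_zero]
      field_simp
      simp
    · have h3 := norm_reject_le (he k) (e l)
      rw [he l, one_pow] at h3
      rw [sub_zero]
      exact mul_le_of_le_one_right (by positivity) h3
  have h4 := Finset.sum_le_sum fun l (_ : l ∈ Finset.univ) => h1 l
  rw [Finset.sum_sub_distrib, Finset.sum_ite_eq' Finset.univ k] at h4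
  simp only [Finset.mem_univ, if_true] at h4
  have h5 : η⁻¹ * (∑ l, ∑ j, ‖G l k‖ ^ 2 * ‖inner ℂ (e l) (reject (e k) (b j))‖ ^ 2 / g l) ≤
      η⁻¹ * (B * g k - g k) :=
    mul_le_mul_of_nonneg_left (h4.trans (by linarith)) (by positivity)
  have h6 : g k * ((Fintype.card n - 1) - (B - 1) / η) =
      g k * (Fintype.card n - 1) - η⁻¹ * (B * g k - g k) := by
    field_simp
  rw [h6]
  linarith

end Rejection

/-- Column `k` of `G` gives the dual vector `q`, orthogonal to every `s l` with `l ≠ k` and with `⟪s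
k, q⟫ = 1`. Projecting its expansion yields `q = G k k • P^⊥ s k`; pair this with `s k`. -/
theorem inv_gram_diag_mul_norm_sq_residual {ι F : Type*} [Fintype ι] [DecidableEq ι]
    [NormedAddCommGroup F] [InnerProductSpace ℂ F] [FiniteDimensional ℂ F] (s : ι → F)
    {G : Matrix ι ι ℂ} (hG : (Matrix.of fun l m => inner ℂ (s l) (s m)) * G = 1) (k : ι) :
    G k k * ((‖(Submodule.span ℂ (s '' {l | l ≠ k}))ᗮ.starProjection (s k)‖ ^ 2 : ℝ) : ℂ) = 1 := by
  set W := Submodule.span ℂ (s '' {l | l ≠ k}) with hW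
  set q : F := ∑ l, G l k • s l with hq
  have hsq : ∀ m, inner ℂ (s m) q = if m = k then 1 else 0 := by
    intro m
    have h := congrFun (congrFun hG m) k
    rw [Matrix.mul_apply, Matrix.one_apply] at h
    rw [← h, hq, inner_sum]
    exact Finset.sum_congr rfl fun l _ => by rw [inner_smul_right, Matrix.of_apply, mul_comm]
  have hqW : q ∈ Wᗮ := by
    rw [hW, Submodule.mem_orthogonal]
    intro w hw
    induction hw using Submodule.span_induction with
    | mem w hw =>
      obtain ⟨m, hm, rfl⟩ := hw
      rw [hsq, if_neg hm]
    | zero => simp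
    | add a b _ _ ha hb => rw [inner_add_left, ha, hb, add_zero]
    | smul c a _ ha => rw [inner_smul_left, ha, mul_zero]
  have hPq : Wᗮ.starProjection q = q := Submodule.starProjection_eq_self_iff.2 hqW
  have hPq' : Wᗮ.starProjection q = G k k • Wᗮ.starProjection (s k) := by
    rw [hq, map_sum, Finset.sum_eq_single k]
    · simp
    · intro l _ hl
      have h : Wᗮ.starProjection (s l) = 0 := by
        refine (Submodule.starProjection_apply_eq_zero_iff _).2 ?_
        rw [Submodule.orthogonal_orthogonal]
        exact Submodule.subset_span ⟨l, hl, rfl⟩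
      simp [h]
    · simp
  have h1 : inner ℂ (s k) q = 1 := by rw [hsq, if_pos rfl]
  rw [← hPq, ← Submodule.starProjection_eq_self_iff.2 hqW, 
    ← Submodule.inner_starProjection_left_eq_right, hPq, ← hPq, hPq',
    inner_smul_right, inner_self_eq_norm_sq_to_K] at h1
  rw [← h1]
  norm_cast

/-! ### From finite shifts to derivatives. -/

theorem tendsto_exp_sub_one_div_sq {N : ℝ → ℝ} {s m : ℝ}
    (hN : Tendsto (fun t => N t / t ^ 2) (𝓝[≠] 0) (𝓝 m)) :
    Tendsto (fun t => (Real.exp (2 * N t / s) - 1) / t ^ 2) (𝓝[≠] 0) (𝓝 (2 * m / s)) := by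
  have ht2 : Tendsto (fun t : ℝ => t ^ 2) (𝓝[≠] 0) (𝓝 0) := by
    have : Tendsto (fun t : ℝ => t ^ 2) (𝓝 0) (𝓝 (0 ^ 2)) := (continuous_pow 2).tendsto 0
    simpa using this.mono_left nhdsWithin_le_nhds
  have hh : Tendsto (fun t => 2 * (N t / t ^ 2) / s) (𝓝[≠] 0) (𝓝 (2 * m / s)) :=
    (hN.const_mul 2).div_const s
  have hh0 : Tendsto (fun t => 2 * N t / s) (𝓝[≠] 0) (𝓝 0) := by
    have h := hh.mul ht2
    rw [mul_zero] at h
    refine h.congr' ?_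
    filter_upwards [self_mem_nhdsWithin] with t ht
    have : t ≠ 0 := ht
    field_simp
  -- `dslope` is defined at `0` too, so zeros of `N` need no separate treatment.
  have hd : Tendsto (dslope Real.exp 0) (𝓝 0) (𝓝 1) := by
    have h := continuousAt_dslope_same.2 (Real.differentiableAt_exp (x := 0))
    have h2 := h.tendsto
    simpa using h2
  have h := hh.mul (hd.comp hh0)
  rw [mul_one] at h
  refine h.congr' ?_
  filter_upwards [self_mem_nhdsWithin] with t ht
  have ht0 : t ≠ 0 := ht
  have h3 := sub_smul_dslope Real.exp 0 (2 * N t / s)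
  rw [Real.exp_zero, sub_zero, smul_eq_mul] at h3
  simp only [Function.comp]
  rw [← h3]
  ring

/-- The Cramér–Rao inequality in one direction, for a mean `E t` that equals a scalar multiple of
the parameter `a t • x + t • v` to first order. -/
theorem sq_deriv_mean_le {F : Type*} [NormedAddCommGroup F] [InnerProductSpace ℂ F]
    {E : ℝ → F} {A a N : ℝ → ℝ} {x v u : F} {α s m : ℝ} {V : F → ℝ}
    (hE : (fun t => E t - (A t : ℂ) • ((a t : ℂ) • x + (t : ℂ) • v)) =o[𝓝[≠] 0] (fun t : ℝ => t))
    (hE0 : E 0 = (α : ℂ) • x) (ha : Tendsto a (𝓝[≠] 0) (𝓝 1)) (hx : x ≠ 0)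
    (hux : inner ℂ u x = 0) (hxv : inner ℂ x v = 0)
    (hN : Tendsto (fun t => N t / t ^ 2) (𝓝[≠] 0) (𝓝 m))
    (hCR : ∀ w t, ((inner ℂ w (E t)).re - (inner ℂ w (E 0)).re) ^ 2 ≤
      V w * (Real.exp (2 * N t / s) - 1)) :
    (α * (inner ℂ u v).re) ^ 2 ≤ V u * (2 * m / s) := by
  have hexp := tendsto_exp_sub_one_div_sq (s := s) hN
  have ht2 : Tendsto (fun t : ℝ => t ^ 2) (𝓝[≠] 0) (𝓝 0) := by
    have : Tendsto (fun t : ℝ => t ^ 2) (𝓝 0) (𝓝 (0 ^ 2)) := (continuous_pow 2).tendsto 0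
    simpa using this.mono_left nhdsWithin_le_nhds
  have hid : Tendsto (fun t : ℝ => t) (𝓝[≠] 0) (𝓝 0) := tendsto_id.mono_left nhdsWithin_le_nhds
  have hexp0 : Tendsto (fun t => Real.exp (2 * N t / s) - 1) (𝓝[≠] 0) (𝓝 0) := by
    have h := hexp.mul ht2
    rw [mul_zero] at h
    refine h.congr' ?_
    filter_upwards [self_mem_nhdsWithin] with t ht
    have : t ≠ 0 := ht
    field_simp
  -- The error term, tested against a vector.
  have herr : ∀ w : F, (fun t => (inner ℂ w (E t)).re -
      A t * (a t * (inner ℂ w x).re + t * (inner ℂ w v).re)) =o[𝓝[≠] 0] (fun t : ℝ => t) := by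
    intro w
    refine (IsBigO.of_bound ‖w‖ (Eventually.of_forall fun t => ?_)).trans_isLittleO hE
    have h : (inner ℂ w (E t)).re - A t * (a t * (inner ℂ w x).re + t * (inner ℂ w v).re) =
        (inner ℂ w (E t - (A t : ℂ) • ((a t : ℂ) • x + (t : ℂ) • v))).re := by
      simp only [inner_sub_right, inner_smul_right, inner_add_right, Complex.sub_re,
        Complex.re_ofReal_mul, Complex.add_re]
    rw [h]
    exact (Complex.abs_re_le_norm _).trans (norm_inner_le_norm _ _)
  -- Continuity of the mean at `0`.
  have hcont : Tendsto (fun t => (inner ℂ x (E t)).re) (𝓝[≠] 0) (𝓝 (inner ℂ x (E 0)).re) := by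
    have h1 : Tendsto (fun t => ((inner ℂ x (E t)).re - (inner ℂ x (E 0)).re) ^ 2)
        (𝓝[≠] 0) (𝓝 0) := by
      have h2 := hexp0.const_mul (V x)
      rw [mul_zero] at h2
      exact squeeze_zero (fun t => sq_nonneg _) (hCR x) h2
    have h3 : Tendsto (fun t => (inner ℂ x (E t)).re - (inner ℂ x (E 0)).re)
        (𝓝[≠] 0) (𝓝 0) := by
      refine (tendsto_zero_iff_abs_tendsto_zero _).2 ?_
      have h4 := h1.sqrt
      simpa [Function.comp_def, Real.sqrt_sq_eq_abs] using h4
    have h5 := h3.add_const (inner ℂ x (E 0)).re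
    simpa using h5
  have hxx : (inner ℂ x x).re = ‖x‖ ^ 2 := by
    rw [inner_self_eq_norm_sq_to_K]; simp [pow_two]
  have hxpos : 0 < ‖x‖ ^ 2 := by positivity
  -- Continuity of the scalar at `0`.
  have hA : Tendsto A (𝓝[≠] 0) (𝓝 α) := by
    -- `A` is not assumed continuous. Testing against `x` isolates `A t * a t * ‖x‖²`, and the mean
    -- is continuous by the information inequality.
    have h1 : Tendsto (fun t => (inner ℂ x (E t)).re -
        A t * (a t * (inner ℂ x x).re + t * (inner ℂ x v).re)) (𝓝[≠] 0) (𝓝 0) :=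
      (herr x).trans_tendsto hid
    have h2 := hcont.sub h1
    rw [sub_zero, hE0, inner_smul_right, Complex.re_ofReal_mul, hxx, hxv] at h2
    have h3 := h2.div (ha.mul_const (‖x‖ ^ 2)) (by simpa using hxpos.ne')
    rw [one_mul, mul_div_cancel_right₀ _ hxpos.ne'] at h3
    refine h3.congr' ?_
    filter_upwards [ha.eventually_ne one_ne_zero] with t ht
    simp only [Complex.zero_re, mul_zero, add_zero, Pi.div_apply, sub_sub_cancel]
    field_simp
  -- As `u ⊥ x`, the term `A t * a t` disappears, so no differentiability of `A` is needed.
  have hD : Tendsto (fun t => ((inner ℂ u (E t)).re - (inner ℂ u (E 0)).re) / t) (𝓝[≠] 0)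
      (𝓝 (α * (inner ℂ u v).re)) := by
    have h1 := (herr u).tendsto_div_nhds_zero
    have h2 := h1.add (hA.mul_const (inner ℂ u v).re)
    rw [zero_add] at h2
    refine h2.congr' ?_
    filter_upwards [self_mem_nhdsWithin] with t ht
    have ht0 : t ≠ 0 := ht
    rw [hE0, inner_smul_right, hux]
    simp only [mul_zero, Complex.zero_re, zero_add, sub_zero]
    field_simp
    ring
  refine le_of_tendsto_of_tendsto (hD.pow 2) (hexp.const_mul (V u)) ?_
  filter_upwards [self_mem_nhdsWithin] with t ht
  have ht0 : t ≠ 0 := ht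
  have h1 := hCR u t
  rw [div_pow, ← mul_div_assoc]
  gcongr

/-! ### Curves in the constraint set and their Fisher information. -/

/-- A curve in the constraint set through `x` that moves only the mode `i`, with velocity `v`. -/
noncomputable def perturb {d K : ℕ} {T : Fin (d + 1) → ℕ} (x : Params d K T) (i : Fin d)
    (v : Fin K → EuclideanSpace ℂ (Fin (T i.castSucc))) (t : ℝ) : Params d K T :=
  Function.update x i.castSucc fun l =>
    ((Real.sqrt (1 - t ^ 2 * ‖v l‖ ^ 2 / T i.castSucc) : ℝ) : ℂ) • x i.castSucc l + (t : ℂ) • v l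

section Perturb

variable {d K : ℕ} {T : Fin (d + 1) → ℕ} (x : Params d K T) (i : Fin d)
    (v : Fin K → EuclideanSpace ℂ (Fin (T i.castSucc)))

theorem perturb_apply (t : ℝ) (l : Fin K) : perturb x i v t i.castSucc l =
    ((Real.sqrt (1 - t ^ 2 * ‖v l‖ ^ 2 / T i.castSucc) : ℝ) : ℂ) • x i.castSucc l +
      (t : ℂ) • v l := by
  simp [perturb]

theorem perturb_zero : perturb x i v 0 = x := by
  simp [perturb]

theorem hasDerivAt_sqrt_one_sub (r : ℝ) :
    HasDerivAt (fun t : ℝ => Real.sqrt (1 - t ^ 2 * r)) 0 0 := by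
  have h : HasDerivAt (fun t : ℝ => 1 - t ^ 2 * r) 0 0 := by
    have := ((hasDerivAt_pow 2 (0 : ℝ)).mul_const r).const_sub 1
    simpa using this
  have := h.sqrt (by simp)
  simpa using this

theorem hasDerivAt_perturb_apply (l : Fin K) :
    HasDerivAt (fun t => perturb x i v t i.castSucc l) (v l) 0 := by
  simp_rw [perturb_apply]
  have h1 : HasDerivAt (fun t : ℝ =>
      ((Real.sqrt (1 - t ^ 2 * ‖v l‖ ^ 2 / T i.castSucc) : ℝ) : ℂ)) ((0 : ℝ) : ℂ) 0 := by
    simp_rw [mul_div_assoc]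
    exact (hasDerivAt_sqrt_one_sub _).ofReal_comp
  have h2 : HasDerivAt (fun t : ℝ => (t : ℂ)) ((1 : ℝ) : ℂ) 0 := (hasDerivAt_id 0).ofReal_comp
  have h := (h1.smul_const (x i.castSucc l)).fun_add (h2.smul_const (v l))
  rw [Complex.ofReal_zero, zero_smul, zero_add, Complex.ofReal_one, one_smul] at h
  exact h

theorem hasDerivAt_perturb : ∃ w, HasDerivAt (perturb x i v) w 0 := by
  refine ⟨Pi.single i.castSucc v, hasDerivAt_pi.2 fun j => hasDerivAt_pi.2 fun l => ?_⟩
  by_cases hj : j = i.castSucc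
  · subst hj
    simpa using hasDerivAt_perturb_apply x i v l
  · simp only [perturb, Function.update_of_ne hj, Pi.single_eq_of_ne hj]
    exact hasDerivAt_const _ _

theorem eventually_perturb_mem
    (hT : ∀ i : Fin d, 1 < T i.castSucc)
    (hx : ∀ (i : Fin d) (k : Fin K), ‖x i.castSucc k‖ ^ 2 = (T i.castSucc : ℝ))
    (hv : ∀ l, inner ℂ (x i.castSucc l) (v l) = 0) :
    ∀ᶠ t in 𝓝 (0 : ℝ), perturb x i v t ∈ constraintSet x := by
  have hTpos : (0 : ℝ) < T i.castSucc := by exact_mod_cast (zero_lt_one.trans (hT i))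
  -- For large `t` the radicand may be negative and `Real.sqrt` returns `0`, so the norm constraint
  -- is claimed only near `0`.
  have h1 : ∀ l, ∀ᶠ t in 𝓝 (0 : ℝ), 0 ≤ 1 - t ^ 2 * ‖v l‖ ^ 2 / T i.castSucc := by
    intro l
    have hc : ContinuousAt (fun t : ℝ => 1 - t ^ 2 * ‖v l‖ ^ 2 / T i.castSucc) 0 := by fun_prop
    have := hc.eventually (lt_mem_nhds (a := 0) (by simp))
    exact this.mono fun t ht => ht.le
  filter_upwards [eventually_all.2 h1] with t ht j l
  have hself : ∀ j l, (inner ℂ (x j l) (x j l)).im = 0 := fun j l => by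
    rw [inner_self_eq_norm_sq_to_K]; simp [pow_two]
  by_cases hj : j = i
  · subst hj
    rw [perturb_apply]
    constructor
    · have h := norm_add_sq (𝕜 := ℂ)
        (((Real.sqrt (1 - t ^ 2 * ‖v l‖ ^ 2 / T j.castSucc) : ℝ) : ℂ) • x j.castSucc l)
        ((t : ℂ) • v l)
      rw [inner_smul_left, inner_smul_right, hv l] at h
      rw [h, norm_smul, norm_smul, mul_pow, mul_pow, hx j l]
      simp only [mul_zero, map_zero, add_zero, Complex.norm_real, Real.norm_eq_abs, sq_abs,
        Real.sq_sqrt (ht l)]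
      field_simp
      ring
    · rw [inner_add_right, inner_smul_right, inner_smul_right, hv l, mul_zero, add_zero,
        Complex.im_ofReal_mul, hself, mul_zero]
  · have hj' : j.castSucc ≠ i.castSucc := fun h => hj (Fin.castSucc_injective _ h)
    rw [perturb, Function.update_of_ne hj']
    exact ⟨hx j l, hself _ _⟩

theorem signal_perturb (t : ℝ) (τ : (i : Fin (d + 1)) → Fin (T i)) :
    signal (perturb x i v t) τ = ∑ l, perturb x i v t i.castSucc l (τ i.castSucc) *
      partialProduct x i.castSucc l fun j => τ j := by
  unfold signal
  refine Finset.sum_congr rfl fun l _ => ?_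
  rw [Fintype.prod_eq_mul_prod_subtype_ne _ i.castSucc]
  congr 1
  refine Finset.prod_congr rfl fun j _ => ?_
  rw [perturb, Function.update_of_ne j.2]

theorem tendsto_signal_perturb :
    Tendsto (fun t => (∑ τ, ‖signal (perturb x i v t) τ - signal x τ‖ ^ 2) / t ^ 2) (𝓝[≠] 0)
      (𝓝 (∑ τ : (i : Fin (d + 1)) → Fin (T i), ‖∑ l, v l (τ i.castSucc) *
        partialProduct x i.castSucc l fun j => τ j‖ ^ 2)) := by
  have hd : ∀ τ, HasDerivAt (fun t => signal (perturb x i v t) τ)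
      (∑ l, v l (τ i.castSucc) * partialProduct x i.castSucc l fun j => τ j) 0 := by
    intro τ
    simp_rw [signal_perturb]
    refine HasDerivAt.fun_sum fun l _ => HasDerivAt.mul_const ?_ _
    exact ((EuclideanSpace.proj (𝕜 := ℂ) (τ i.castSucc)).restrictScalars
      ℝ).hasFDerivAt.comp_hasDerivAt 0 (hasDerivAt_perturb_apply x i v l)
  have h := tendsto_finsetSum Finset.univ fun τ _ =>
    ((hasDerivAt_iff_tendsto_slope.1 (hd τ)).norm.pow 2)
  refine h.congr fun t => ?_
  rw [Finset.sum_div]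
  refine Finset.sum_congr rfl fun τ _ => ?_
  rw [slope_def_module, perturb_zero, norm_smul, mul_pow]
  simp
  ring

/-- This is `‖∑ v l ⊗ s l‖²` expanded: splitting off the coordinate `τ i` factors each inner product
of tensors. -/
theorem sum_norm_sq_signal_deriv (i : Fin (d + 1)) (v : Fin K → EuclideanSpace ℂ (Fin (T i))) :
    ((∑ τ : (i : Fin (d + 1)) → Fin (T i),
      ‖∑ l, v l (τ i) * partialProduct x i l fun j => τ j‖ ^ 2 : ℝ) : ℂ) =
      ∑ l, ∑ m, gramMatrix x i l m * inner ℂ (v l) (v m) := by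
  have h1 : ∀ l m, gramMatrix x i l m * inner ℂ (v l) (v m) =
      ∑ τ : (i : Fin (d + 1)) → Fin (T i),
        star (v l (τ i) * partialProduct x i l fun j => τ j) *
          (v m (τ i) * partialProduct x i m fun j => τ j) := by
    intro l m
    rw [← (Equiv.piSplitAt i fun j => Fin (T j)).symm.sum_comp, Fintype.sum_prod_type]
    simp only [gramMatrix, Matrix.mul_apply, Matrix.conjTranspose_apply, partialMatrix,
      Matrix.of_apply, PiLp.inner_apply, RCLike.inner_apply, Equiv.piSplitAt_symm_apply,
      dite_true, Finset.sum_mul_sum]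
    rw [Finset.sum_comm]
    refine Finset.sum_congr rfl fun a _ => Finset.sum_congr rfl fun b _ => ?_
    have : (fun j : {j // j ≠ i} => (if h : (j : Fin (d + 1)) = i then h.symm.rec a else b ⟨j, h⟩ :
        Fin (T j))) = b := by
      ext j; rw [dif_neg j.2]
    rw [star_mul']
    simp only [RCLike.star_def]
    rw [this]
    ring
  simp_rw [h1]
  rw [Complex.ofReal_sum]
  simp_rw [Finset.sum_comm (s := Finset.univ (α := Fin K))
    (t := Finset.univ (α := (i : Fin (d + 1)) → Fin (T i)))]
  refine Finset.sum_congr rfl fun τ _ => ?_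
  rw [Complex.ofReal_pow, ← Complex.conj_mul', map_sum, Finset.sum_mul_sum]
  rfl

end Perturb

theorem re_form_diagonal {ι : Type*} [Fintype ι] [DecidableEq ι] (η : ℝ) (g : ι → ℝ) (c : ι → ℂ) :
    (star c ⬝ᵥ ((η : ℂ) • Matrix.diagonal fun l => (g l : ℂ)).mulVec c).re =
      η * ∑ l, g l * ‖c l‖ ^ 2 := by
  rw [Matrix.smul_mulVec, dotProduct_smul, smul_eq_mul, Complex.re_ofReal_mul, dotProduct,
    Complex.re_sum]
  congr 1
  refine Finset.sum_congr rfl fun l _ => ?_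
  have : star (c l) * ((g l : ℂ) * c l) = ((g l * ‖c l‖ ^ 2 : ℝ) : ℂ) := by
    push_cast
    rw [← Complex.conj_mul', RCLike.star_def]
    ring
  rw [Matrix.mulVec_diagonal, Pi.star_apply, this, Complex.ofReal_re]

theorem gramMatrix_eq_inner {d K : ℕ} {T : Fin (d + 1) → ℕ} (x : Params d K T)
    (i : Fin (d + 1)) : gramMatrix x i =
      Matrix.of fun l m => inner ℂ (partialProduct x i l) (partialProduct x i m) := by
  ext l m
  simp [gramMatrix, Matrix.mul_apply, partialMatrix, PiLp.inner_apply, mul_comm]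

/-! ### Cramér–Rao bounds for the estimator. -/

section Estimator

variable {d K : ℕ} {T : Fin (d + 1) → ℕ} {σ : ℝ} {x : Params d K T} {z : Obs T → Params d K T}

theorem measurable_mode (hz : Measurable z) (i : Fin (d + 1)) (k : Fin K) :
    Measurable fun y => z y i k :=
  (measurable_pi_apply k).comp ((measurable_pi_apply i).comp hz)

theorem ae_norm_mode_le (hconstr : ∀ᵐ y ∂(obsLaw σ x), z y ∈ constraintSet x) (i : Fin d)
    (k : Fin K) : ∀ᵐ y ∂(obsLaw σ x), ‖z y i.castSucc k‖ ≤ Real.sqrt (T i.castSucc) := by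
  filter_upwards [hconstr] with y hy
  rw [← (hy i k).1, Real.sqrt_sq (norm_nonneg _)]

theorem memLp_mode (hz : Measurable z)
    (hconstr : ∀ᵐ y ∂(obsLaw σ x), z y ∈ constraintSet x) (i : Fin d) (k : Fin K) :
    MemLp (fun y => z y i.castSucc k) 2 (obsLaw σ x) :=
  MemLp.of_bound (measurable_mode hz _ k).aestronglyMeasurable _ (ae_norm_mode_le hconstr i k)

theorem sq_re_inner_mean_sub_le (hσ : 0 < σ) (hz : Measurable z)
    (hconstr : ∀ᵐ y ∂(obsLaw σ x), z y ∈ constraintSet x) (i : Fin d) (k : Fin K)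
    (w : EuclideanSpace ℂ (Fin (T i.castSucc))) (θ : Params d K T) :
    ((inner ℂ w (∫ y, z y i.castSucc k ∂(obsLaw σ θ))).re -
        (inner ℂ w (∫ y, z y i.castSucc k ∂(obsLaw σ x))).re) ^ 2 ≤
      (∫ y, (inner ℂ w (z y i.castSucc k)).re ^ 2 ∂(obsLaw σ x)) *
        (Real.exp (2 * (∑ τ, ‖signal θ τ - signal x τ‖ ^ 2) / σ ^ 2) - 1) := by
  obtain ⟨L, hL, hLd, hL2⟩ := exists_density_obsLaw hσ x θ
  have hm := measurable_mode hz i.castSucc k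
  have hb := ae_norm_mode_le hconstr i k
  -- The constraint is assumed almost surely only at `x`; absolute continuity carries the resulting
  -- norm bound, hence integrability, to `θ`.
  have hac : obsLaw σ θ ≪ obsLaw σ x := by
    rw [hLd]; exact withDensity_absolutelyContinuous _ _
  have hre : ∀ P : Measure (Obs T), IsProbabilityMeasure P → P ≪ obsLaw σ x →
      (inner ℂ w (∫ y, z y i.castSucc k ∂P)).re =
        ∫ y, (inner ℂ w (z y i.castSucc k)).re ∂P := by
    intro P _ hP
    have hi : Integrable (fun y => z y i.castSucc k) P :=
      Integrable.of_bound hm.aestronglyMeasurable _ (hP.ae_le hb)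
    rw [← integral_inner hi]
    exact (Complex.reCLM.integral_comp_comm (hi.const_inner w)).symm
  rw [hre _ inferInstance hac, hre _ inferInstance Measure.AbsolutelyContinuous.rfl]
  have hprob : IsProbabilityMeasure ((obsLaw σ x).withDensity L) := hLd ▸ inferInstance
  rw [hLd]
  refine sq_integral_withDensity_sub_le hL (Real.exp_pos _).le hL2
    (B := ‖w‖ * Real.sqrt (T i.castSucc)) ?_ ?_
  · exact Complex.measurable_re.comp (hm.const_inner)
  · filter_upwards [hb] with y hy
    refine ((Complex.abs_re_le_norm _).trans (norm_inner_le_norm _ _)).trans ?_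
    gcongr

theorem isLittleO_mean_perturb
    (hT : ∀ i : Fin d, 1 < T i.castSucc)
    (hx : ∀ (i : Fin d) (k : Fin K), ‖x i.castSucc k‖ ^ 2 = (T i.castSucc : ℝ))
    {α : Params d K T → Fin d → Fin K → ℝ} (hbias : HasScalarBias σ x z α)
    {i : Fin d} {v : Fin K → EuclideanSpace ℂ (Fin (T i.castSucc))}
    (hv : ∀ l, inner ℂ (x i.castSucc l) (v l) = 0) (k : Fin K) :
    (fun t : ℝ => (∫ y, z y i.castSucc k ∂(obsLaw σ (perturb x i v t))) -
      (α (perturb x i v t) i k : ℂ) • perturb x i v t i.castSucc k)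
      =o[𝓝[≠] 0] (fun t : ℝ => t) := by
  obtain ⟨w, hw⟩ := hasDerivAt_perturb x i v
  have hlim : Tendsto (perturb x i v) (𝓝[≠] 0) (𝓝[constraintSet x] x) := by
    refine tendsto_nhdsWithin_iff.2 ⟨?_, ?_⟩
    · have := hw.continuousAt.tendsto
      rw [perturb_zero] at this
      exact this.mono_left nhdsWithin_le_nhds
    · exact (eventually_perturb_mem x i v hT hx hv).filter_mono nhdsWithin_le_nhds
  have hO : (fun t => perturb x i v t - x) =O[𝓝[≠] 0] (fun t : ℝ => t) := by
    have := hw.isBigO_sub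
    simp only [perturb_zero, sub_zero] at this
    exact this.mono nhdsWithin_le_nhds
  exact ((hbias i k).comp_tendsto hlim).trans_isBigO hO

theorem self_mem_constraintSet
    (hx : ∀ (i : Fin d) (k : Fin K), ‖x i.castSucc k‖ ^ 2 = (T i.castSucc : ℝ)) :
    x ∈ constraintSet x := fun i k =>
  ⟨hx i k, by rw [inner_self_eq_norm_sq_to_K]; simp [pow_two]⟩

/-- The neighbourhood filter is not punctured and `x` lies in the constraint set, so the little-o at
`θ = x` forces equality. -/
theorem mean_eq_of_hasScalarBias
    (hx : ∀ (i : Fin d) (k : Fin K), ‖x i.castSucc k‖ ^ 2 = (T i.castSucc : ℝ))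
    {α : Params d K T → Fin d → Fin K → ℝ} (hbias : HasScalarBias σ x z α) (i : Fin d)
    (k : Fin K) :
    ∫ y, z y i.castSucc k ∂(obsLaw σ x) = (α x i k : ℂ) • x i.castSucc k := by
  have h := ((hbias i k).def one_pos).self_of_nhdsWithin (self_mem_constraintSet hx)
  simp only [sub_self, norm_zero, mul_zero] at h
  exact sub_eq_zero.1 (norm_le_zero_iff.1 h)

theorem sq_bias_mul_re_inner_le (hσ : 0 < σ)
    (hT : ∀ i : Fin d, 1 < T i.castSucc)
    (hx : ∀ (i : Fin d) (k : Fin K), ‖x i.castSucc k‖ ^ 2 = (T i.castSucc : ℝ))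
    (hz : Measurable z) (hconstr : ∀ᵐ y ∂(obsLaw σ x), z y ∈ constraintSet x)
    {α : Params d K T → Fin d → Fin K → ℝ} (hbias : HasScalarBias σ x z α)
    {i : Fin d} {v : Fin K → EuclideanSpace ℂ (Fin (T i.castSucc))}
    (hv : ∀ l, inner ℂ (x i.castSucc l) (v l) = 0) {k : Fin K}
    {u : EuclideanSpace ℂ (Fin (T i.castSucc))} (hu : inner ℂ u (x i.castSucc k) = 0)
    {m : ℝ} (hm : ∑ l, ∑ l', gramMatrix x i.castSucc l l' * inner ℂ (v l) (v l') = m) :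
    (α x i k * (inner ℂ u (v k)).re) ^ 2 ≤
      (∫ y, (inner ℂ u (z y i.castSucc k)).re ^ 2 ∂(obsLaw σ x)) * (2 * m / σ ^ 2) := by
  have hTpos : (0 : ℝ) < T i.castSucc := by exact_mod_cast (zero_lt_one.trans (hT i))
  have hN := tendsto_signal_perturb x i v
  have hm' := sum_norm_sq_signal_deriv x i.castSucc v
  rw [hm, Complex.ofReal_inj] at hm'
  rw [hm'] at hN
  have hE := isLittleO_mean_perturb hT hx hbias hv k
  simp only [perturb_apply] at hE
  refine sq_deriv_mean_le (E := fun t => ∫ y, z y i.castSucc k ∂(obsLaw σ (perturb x i v t)))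
    (x := x i.castSucc k) (s := σ ^ 2)
    (V := fun w => ∫ y, (inner ℂ w (z y i.castSucc k)).re ^ 2 ∂(obsLaw σ x))
    hE ?_ ?_ ?_ hu (hv k) hN ?_
  · simp only [perturb_zero]
    exact mean_eq_of_hasScalarBias hx hbias i k
  · have h : ContinuousAt
        (fun t : ℝ => Real.sqrt (1 - t ^ 2 * ‖v k‖ ^ 2 / T i.castSucc)) 0 := by fun_prop
    have h2 := h.tendsto.mono_left (nhdsWithin_le_nhds (s := {0}ᶜ))
    simpa using h2
  · intro h0
    have := hx i k
    rw [h0, norm_zero] at this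
    norm_num at this
    exact hTpos.ne this
  · intro w t
    simp only [perturb_zero]
    exact sq_re_inner_mean_sub_le hσ hz hconstr i k w _

/-- The Cramér–Rao inequality for the complex scalar `⟪u, ẑ⟫`, at a direction `v` at which the
Fisher information equals the derivative of the mean. -/
theorem bias_sq_mul_re_inner_le_integral (hσ : 0 < σ)
    (hT : ∀ i : Fin d, 1 < T i.castSucc)
    (hx : ∀ (i : Fin d) (k : Fin K), ‖x i.castSucc k‖ ^ 2 = (T i.castSucc : ℝ))
    (hz : Measurable z) (hconstr : ∀ᵐ y ∂(obsLaw σ x), z y ∈ constraintSet x)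
    {α : Params d K T → Fin d → Fin K → ℝ} (hbias : HasScalarBias σ x z α)
    {i : Fin d} {v : Fin K → EuclideanSpace ℂ (Fin (T i.castSucc))}
    (hv : ∀ l, inner ℂ (x i.castSucc l) (v l) = 0) {k : Fin K}
    {u : EuclideanSpace ℂ (Fin (T i.castSucc))} (hu : inner ℂ u (x i.castSucc k) = 0)
    (hm : ∑ l, ∑ l', gramMatrix x i.castSucc l l' * inner ℂ (v l) (v l') = inner ℂ (v k) u) :
    σ ^ 2 * (α x i k) ^ 2 * (inner ℂ u (v k)).re ≤
      ∫ y, ‖inner ℂ u (z y i.castSucc k)‖ ^ 2 ∂(obsLaw σ x) := by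
  set ρ := (inner ℂ u (v k)).re with hρ
  have hsum := sum_norm_sq_signal_deriv x i.castSucc v
  have hρeq : ∑ l, ∑ l', gramMatrix x i.castSucc l l' * inner ℂ (v l) (v l') = (ρ : ℂ) := by
    rw [← hsum]
    congr 1
    rw [hρ, ← inner_conj_symm, Complex.conj_re, ← hm, ← hsum, Complex.ofReal_re]
  have hρ0 : 0 ≤ ρ := by
    rw [← hsum, Complex.ofReal_inj] at hρeq
    rw [← hρeq]
    exact Finset.sum_nonneg fun _ _ => sq_nonneg _
  have hI : ∀ a b : EuclideanSpace ℂ (Fin (T i.castSucc)),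
      inner ℂ (Complex.I • a) (Complex.I • b) = inner ℂ a b := fun a b => by
    rw [inner_smul_left, inner_smul_right, ← mul_assoc]
    simp
  have h1 := sq_bias_mul_re_inner_le hσ hT hx hz hconstr hbias hv hu hρeq
  -- Multiplying `u` and `v` by `I` preserves all inner products and turns the real part of `⟪u, ẑ⟫`
  -- into its imaginary part; each part contributes half the bound.
  have h2 := sq_bias_mul_re_inner_le hσ hT hx hz hconstr hbias (v := fun l => Complex.I • v l)
    (fun l => by rw [inner_smul_right, hv, mul_zero]) (k := k) (u := Complex.I • u)
    (by rw [inner_smul_left, hu, mul_zero]) (m := ρ) (by simp_rw [hI]; exact hρeq)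
  rw [hI] at h2
  have hLp := (memLp_mode hz hconstr i k).const_inner (𝕜 := ℂ) u
  have hLp' := (memLp_mode hz hconstr i k).const_inner (𝕜 := ℂ) (Complex.I • u)
  have hsplit : ∫ y, ‖inner ℂ u (z y i.castSucc k)‖ ^ 2 ∂(obsLaw σ x) =
      ∫ y, (inner ℂ u (z y i.castSucc k)).re ^ 2 ∂(obsLaw σ x) +
        ∫ y, (inner ℂ (Complex.I • u) (z y i.castSucc k)).re ^ 2 ∂(obsLaw σ x) := by
    refine Eq.trans ?_ (integral_add hLp.re.integrable_sq hLp'.re.integrable_sq)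
    refine integral_congr_ae (ae_of_all _ fun y => ?_)
    simp only [inner_smul_left]
    rw [← Complex.normSq_eq_norm_sq, Complex.normSq_apply]
    simp
    ring
  have hhalf : ∀ W : ℝ, 0 ≤ W → (α x i k * ρ) ^ 2 ≤ W * (2 * ρ / σ ^ 2) →
      σ ^ 2 * (α x i k) ^ 2 * ρ / 2 ≤ W := by
    intro W hW h
    rcases hρ0.eq_or_lt with h0 | h0
    · rw [← h0]; simpa using hW
    · rw [← mul_div_assoc, le_div_iff₀ (by positivity)] at h
      refine le_of_mul_le_mul_right (a := 2 * ρ) ?_ (by positivity)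
      linarith
  rw [hsplit]
  have := hhalf _ (integral_nonneg fun y => sq_nonneg _) h1
  have := hhalf _ (integral_nonneg fun y => sq_nonneg _) h2
  linarith

/-- Projecting away `e` annihilates `a • e` and does not increase the norm. -/
theorem sum_integral_inner_reject_le
    (hz : Measurable z) (hconstr : ∀ᵐ y ∂(obsLaw σ x), z y ∈ constraintSet x)
    {i : Fin d} {k : Fin K}
    (b : OrthonormalBasis (Fin (T i.castSucc)) ℂ (EuclideanSpace ℂ (Fin (T i.castSucc))))
    {e : EuclideanSpace ℂ (Fin (T i.castSucc))} (he : ‖e‖ = 1) (a : ℂ) :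
    ∑ j, ∫ y, ‖inner ℂ (reject e (b j)) (z y i.castSucc k)‖ ^ 2 ∂(obsLaw σ x) ≤
      ∫ y, ‖z y i.castSucc k - a • e‖ ^ 2 ∂(obsLaw σ x) := by
  have hLp := memLp_mode hz hconstr i k
  rw [← integral_finsetSum _ fun j _ => (hLp.const_inner (𝕜 := ℂ) _).norm.integrable_sq]
  refine integral_mono (integrable_finsetSum _ fun j _ =>
    (hLp.const_inner (𝕜 := ℂ) _).norm.integrable_sq)
    (hLp.sub (memLp_const _)).norm.integrable_sq fun y => ?_
  simp only
  rw [sum_norm_sq_inner_reject, ← reject_sub_smul he _ a]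
  exact norm_reject_le he _

end Estimator

/-! ### Summation over the projected basis. -/

theorem proposition2 (d K : ℕ) (T : Fin (d + 1) → ℕ)
    (hT : ∀ i : Fin d, 1 < T i.castSucc)
    (σ : ℝ) (hσ : 0 < σ)
    (x : Params d K T)
    (hx : ∀ (i : Fin d) (k : Fin K), ‖x i.castSucc k‖ ^ 2 = (T i.castSucc : ℝ))
    (i : Fin d)
    (hΓ : IsUnit (gramMatrix x i.castSucc))
    (ηm ηp : ℝ) (hηm : 0 < ηm)
    (hlower : ((gramMatrix x i.castSucc)⁻¹ - (ηm : ℂ) • gramInvDiag x i.castSucc).PosSemidef)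
    (hupper : ((ηp : ℂ) • gramInvDiag x i.castSucc - (gramMatrix x i.castSucc)⁻¹).PosSemidef)
    (z : Obs T → Params d K T) (hz : Measurable z)
    (hconstr : ∀ᵐ y ∂(obsLaw σ x), z y ∈ constraintSet x)
    (α : Params d K T → Fin d → Fin K → ℝ)
    (hbias : HasScalarBias σ x z α)
    (k : Fin K) (hα : α x i k ≠ 0) :
    xiStar σ x ηm ηp i.castSucc k ≤ normalizedVariance σ x z (α x i k) i.castSucc k := by
  set G := (gramMatrix x i.castSucc)⁻¹ with hGdef
  have hT1 : (1 : ℝ) < T i.castSucc := by exact_mod_cast hT i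
  have hΓG : gramMatrix x i.castSucc * G = 1 :=
    Matrix.mul_nonsing_inv _ ((Matrix.isUnit_iff_isUnit_det _).1 hΓ)
  have hG : G.IsHermitian := (Matrix.isHermitian_conjTranspose_mul_self _).inv
  have hres : ∀ l, G l l * ((‖residualVec x i.castSucc l‖ ^ 2 : ℝ) : ℂ) = 1 := fun l =>
    inv_gram_diag_mul_norm_sq_residual (partialProduct x i.castSucc)
      (by rw [← gramMatrix_eq_inner]; exact hΓG) l
  have hres0 : ∀ l, 0 < ‖residualVec x i.castSucc l‖ ^ 2 := fun l => by
    refine (sq_nonneg _).lt_of_ne fun h => ?_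
    have := hres l
    rw [← h] at this
    simp at this
  set g : Fin K → ℝ := fun l => (‖residualVec x i.castSucc l‖ ^ 2)⁻¹ with hgdef
  have hg : ∀ l, 0 < g l := fun l => inv_pos.2 (hres0 l)
  have hgG : ∀ l, G l l = g l := fun l => by
    rw [hgdef, Complex.ofReal_inv]
    exact eq_inv_of_mul_eq_one_left (hres l)
  have hdiag : gramInvDiag x i.castSucc = Matrix.diagonal fun l => (g l : ℂ) := by
    rw [gramInvDiag, ← hGdef]
    exact congrArg _ (funext hgG)
  rw [hdiag] at hlower hupper
  have hlow : ∀ c : Fin K → ℂ, ηm * ∑ l, g l * ‖c l‖ ^ 2 ≤ (star c ⬝ᵥ G.mulVec c).re := by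
    intro c
    have h : 0 ≤ Complex.re _ := hlower.re_dotProduct_nonneg c
    rw [Matrix.sub_mulVec, dotProduct_sub, Complex.sub_re, re_form_diagonal] at h
    linarith
  have hupp : ∀ c : Fin K → ℂ, (star c ⬝ᵥ G.mulVec c).re ≤ ηp * ∑ l, g l * ‖c l‖ ^ 2 := by
    intro c
    have h : 0 ≤ Complex.re _ := hupper.re_dotProduct_nonneg c
    rw [Matrix.sub_mulVec, dotProduct_sub, Complex.sub_re, re_form_diagonal] at h
    linarith
  have hcol := sum_sq_norm_col_div_le hG hg hgG hηm hlow hupp k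
  have hs0 : Real.sqrt (T i.castSucc) ≠ 0 := (Real.sqrt_pos.2 (by linarith)).ne'
  set e : Fin K → EuclideanSpace ℂ (Fin (T i.castSucc)) := fun l =>
    (((Real.sqrt (T i.castSucc))⁻¹ : ℝ) : ℂ) • x i.castSucc l with hedef
  have hxe : ∀ l, x i.castSucc l = ((Real.sqrt (T i.castSucc) : ℝ) : ℂ) • e l := fun l => by
    rw [hedef, smul_smul, ← Complex.ofReal_mul, mul_inv_cancel₀ hs0, Complex.ofReal_one, one_smul]
  have he : ∀ l, ‖e l‖ = 1 := fun l => by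
    have h : ‖x i.castSucc l‖ = Real.sqrt (T i.castSucc) := by
      rw [← hx i l, Real.sqrt_sq (norm_nonneg _)]
    rw [hedef, norm_smul, h, Complex.norm_real, Real.norm_eq_abs, abs_of_nonneg (by positivity),
      inv_mul_cancel₀ hs0]
  let b := EuclideanSpace.basisFun (Fin (T i.castSucc)) ℂ
  have hterm : ∀ j, σ ^ 2 * (α x i k) ^ 2 * (g k * ‖reject (e k) (b j)‖ ^ 2 -
      ηm⁻¹ * ∑ l, ‖G l k‖ ^ 2 * ‖inner ℂ (e l) (reject (e k) (b j))‖ ^ 2 / g l) ≤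
      ∫ y, ‖inner ℂ (reject (e k) (b j)) (z y i.castSucc k)‖ ^ 2 ∂(obsLaw σ x) := by
    intro j
    obtain ⟨v, hv, hform, hval⟩ :=
      exists_orthogonal_direction hΓG hG hg hgG hηm hlow he k (reject (e k) (b j))
    refine le_trans (mul_le_mul_of_nonneg_left hval (by positivity)) ?_
    refine bias_sq_mul_re_inner_le_integral hσ hT hx hz hconstr hbias (fun l => ?_) ?_ hform
    · rw [hxe, inner_smul_left, hv, mul_zero]
    · rw [hxe, inner_smul_right, inner_eq_zero_symm.1 (inner_reject (he k) _), mul_zero]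
  have htotal := Finset.sum_le_sum fun j (_ : j ∈ Finset.univ) => hterm j
  rw [← Finset.mul_sum] at htotal
  have hbound := le_sum_reject_bound b hg hgG hηm hcol he
  -- The coefficient is `α √T` because `x k = √T • e k`.
  have hvar := sum_integral_inner_reject_le hz hconstr (k := k) b (he k)
    ((α x i k : ℂ) * ((Real.sqrt (T i.castSucc) : ℝ) : ℂ))
  simp only [mul_smul, ← hxe] at hvar
  rw [Fintype.card_fin] at hbound
  have hfinal := (mul_le_mul_of_nonneg_left hbound
    (by positivity : 0 ≤ σ ^ 2 * (α x i k) ^ 2)).trans (htotal.trans hvar)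
  rw [normalizedVariance, le_div_iff₀ (by positivity)]
  refine le_trans (le_of_eq ?_) hfinal
  have hT2 : (T i.castSucc : ℝ) - 1 ≠ 0 := by linarith
  have hr := (hres0 k).ne'
  rw [xiStar, hgdef]
  field_simp
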